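/- For $\beta\in(1,2)$, a $\beta$-expansion of a real number $x$ is a sequence $(a_1,a_2,\dots)\in\{0,1\}^{\mathbb N}$ with $x=\sum_{k\ge1}a_k\beta^{-k}$. Let $I_\beta=[0,\frac1{\beta-1}]$, and for $x\in I_\beta$ let $\mathcal E_n(x;\beta)\subseteq\{0,1\}^n$ be the set of words of length $n$ that are prefixes of $\beta$-expansions of $x$. The maximal growth exponent of $\beta$ is $$\mathfrak M_\beta=\sup_{x\in I_\beta}\ \limsup_{n\to\infty}\sqrt[n]{\#\mathcal E_n(x;\beta)}.$$ For an integer $m\ge2$ let $\tau_m$ be the $m$-th multinacci number, that is, the positive (equivalently, the largest) real root of $x^m=x^{m-1}+x^{m-2}+\dots+x+1$, and let $\tau=\tau_2=\frac{1+\sqrt5}2$. Then $$\mathfrak M_{\tau_m}=\begin{cases}\sqrt\tau,&m=2,\\ 2^{1/(m+1)},&m\ge3.\end{cases}$$ -/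

import Mathlib

open Filter Topology

/-- `a = (a₁, a₂, …) ∈ {0,1}^ℕ` (with `a_{k+1}` stored at index `k`) is a `β`-expansion of `x`:
`x = ∑_{k ≥ 1} a_k β^{-k}`. -/
def IsBetaExpansion (β x : ℝ) (a : ℕ → Fin 2) : Prop :=
  HasSum (fun k : ℕ => ((a k : ℕ) : ℝ) * (β ^ (k + 1))⁻¹) x

/-- The set of `0`-`1` words of length `n` that are prefixes of `β`-expansions of `x`. -/
def prefixSet (β x : ℝ) (n : ℕ) : Set (Fin n → Fin 2) :=
  {w | ∃ a : ℕ → Fin 2, IsBetaExpansion β x a ∧ ∀ i : Fin n, a i = w i}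

/-- The (upper) exponential growth rate `limsup_n (#prefixSet)^{1/n}` at the point `x`. -/
noncomputable def growthExponent (β x : ℝ) : ℝ :=
  limsup (fun n : ℕ => ((prefixSet β x n).ncard : ℝ) ^ (1 / (n : ℝ))) atTop

/-- The maximal growth exponent: the supremum of the growth rates over `x ∈ [0, 1/(β-1)]`. -/
noncomputable def maximalGrowthExponent (β : ℝ) : ℝ :=
  ⨆ x : Set.Icc (0 : ℝ) (1 / (β - 1)), growthExponent β x

/-- The `m`-th multinacci number: the largest real root of
`x^m = x^{m-1} + x^{m-2} + ⋯ + x + 1`. -/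
noncomputable def multinacci (m : ℕ) : ℝ :=
  sSup {x : ℝ | x ^ m = ∑ i ∈ Finset.range m, x ^ i}

/-! The facts below show that the `limsup`, the suprema and the root above are genuine. -/

theorem prefixSet_rpow_mem_Icc (β x : ℝ) (n : ℕ) :
    ((prefixSet β x n).ncard : ℝ) ^ (1 / (n : ℝ)) ∈ Set.Icc (0 : ℝ) 2 := by
  refine ⟨by positivity, ?_⟩
  rcases Nat.eq_zero_or_pos n with rfl | hn
  · simp
  · have h : (prefixSet β x n).ncard ≤ 2 ^ n := by
      have := Set.ncard_le_card (prefixSet β x n)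
      simpa using this
    have h' : ((prefixSet β x n).ncard : ℝ) ≤ 2 ^ n := by exact_mod_cast h
    calc ((prefixSet β x n).ncard : ℝ) ^ (1 / (n : ℝ))
        ≤ ((2 : ℝ) ^ n) ^ (1 / (n : ℝ)) :=
          Real.rpow_le_rpow (by positivity) h' (by positivity)
      _ = 2 := by
          rw [one_div]
          exact Real.pow_rpow_inv_natCast (by norm_num) hn.ne'

theorem prefixSet_isBoundedUnder (β x : ℝ) :
    IsBoundedUnder (· ≤ ·) atTop
      (fun n : ℕ => ((prefixSet β x n).ncard : ℝ) ^ (1 / (n : ℝ))) :=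
  isBoundedUnder_of ⟨2, fun n => (prefixSet_rpow_mem_Icc β x n).2⟩

theorem prefixSet_isCoboundedUnder (β x : ℝ) :
    IsCoboundedUnder (· ≤ ·) atTop
      (fun n : ℕ => ((prefixSet β x n).ncard : ℝ) ^ (1 / (n : ℝ))) :=
  IsBoundedUnder.isCoboundedUnder_le
    (isBoundedUnder_of ⟨0, fun n => (prefixSet_rpow_mem_Icc β x n).1⟩)

theorem bddAbove_growthExponent (β : ℝ) :
    BddAbove (Set.range fun x : Set.Icc (0 : ℝ) (1 / (β - 1)) => growthExponent β x) := by
  refine ⟨2, ?_⟩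
  rintro _ ⟨x, rfl⟩
  exact limsup_le_of_le (prefixSet_isCoboundedUnder β x)
    (Eventually.of_forall fun n => (prefixSet_rpow_mem_Icc β x n).2)

theorem existsUnique_multinacci {m : ℕ} (hm : 2 ≤ m) :
    ∃! x : ℝ, 0 < x ∧ x ^ m = ∑ i ∈ Finset.range m, x ^ i := by
  have hinj : ∀ x y : ℝ, 0 < x → x < y → x ^ m = ∑ i ∈ Finset.range m, x ^ i →
      y ^ m = ∑ i ∈ Finset.range m, y ^ i → False := by
    intro x y hx hxy h1 h2
    have hy := hx.trans hxy
    have hlt : ∑ i ∈ Finset.range m, x ^ m * y ^ i < ∑ i ∈ Finset.range m, y ^ m * x ^ i := by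
      refine Finset.sum_lt_sum_of_nonempty ⟨0, by simp; omega⟩ fun i hi => ?_
      have hi' : i < m := Finset.mem_range.1 hi
      obtain ⟨k, rfl⟩ := Nat.exists_eq_add_of_lt hi'
      have : x ^ (k + 1) < y ^ (k + 1) := pow_lt_pow_left₀ hxy hx.le (by omega)
      have h0 : 0 < x ^ i * y ^ i := by positivity
      have := mul_lt_mul_of_pos_left this h0
      calc x ^ (i + k + 1) * y ^ i = x ^ i * y ^ i * x ^ (k + 1) := by ring
        _ < x ^ i * y ^ i * y ^ (k + 1) := this
        _ = y ^ (i + k + 1) * x ^ i := by ring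
    rw [← Finset.mul_sum, ← Finset.mul_sum, ← h1, ← h2, mul_comm] at hlt
    exact lt_irrefl _ hlt
  have hcont : ContinuousOn (fun x : ℝ => x ^ m - ∑ i ∈ Finset.range m, x ^ i) (Set.Icc 1 2) := by
    fun_prop
  have hgeom : (∑ i ∈ Finset.range m, (2 : ℝ) ^ i) = 2 ^ m - 1 := by
    rw [geom_sum_eq (by norm_num)]; norm_num
  have hm' : (2 : ℝ) ≤ m := by exact_mod_cast hm
  obtain ⟨x, hx, hx0⟩ := intermediate_value_Icc (by norm_num : (1 : ℝ) ≤ 2) hcont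
    (show (0 : ℝ) ∈ _ by
      constructor
      · simp; linarith
      · simp only [hgeom]; linarith)
  have hx1 : 0 < x := by linarith [hx.1]
  have hx2 : x ^ m = ∑ i ∈ Finset.range m, x ^ i := sub_eq_zero.1 hx0
  refine ⟨x, ⟨hx1, hx2⟩, ?_⟩
  rintro y ⟨hy1, hy2⟩
  rcases lt_trichotomy y x with h | h | h
  · exact (hinj y x hy1 h hy2 hx2).elim
  · exact h
  · exact (hinj x y hx1 h hx2 hy2).elim

theorem multinacci_isGreatest {m : ℕ} (hm : 2 ≤ m) :
    IsGreatest {x : ℝ | x ^ m = ∑ i ∈ Finset.range m, x ^ i} (multinacci m) := by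
  obtain ⟨x, ⟨hx1, hx2⟩, hu⟩ := existsUnique_multinacci hm
  have h : IsGreatest {x : ℝ | x ^ m = ∑ i ∈ Finset.range m, x ^ i} x := by
    refine ⟨hx2, fun y hy => ?_⟩
    rcases le_or_gt y 0 with h | h
    · exact h.trans hx1.le
    · exact (hu y ⟨h, hy⟩).le
  have : multinacci m = x := h.csSup_eq
  rwa [this]

/-!
Write `β` for the multinacci number and `L = 1/(β-1)`, and count the branches of length `n` of the
maps `y ↦ βy`, `y ↦ βy - 1` that keep `x` in `[0, L]`. These counts are invariant under `x ↦ L - x`,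
and the equation of `β` amounts to `β^m (2 - β) = 1`, that is `β^m (L - 1) = L`.

A point which branches has two images `s` and `s + 1`. The next `m - 1` digits are forced, all `0`
at `s` and all `1` at `s + 1`, and the `m`-th step leads to `t`, `t - 1` from `s` and to `t`,
`t + 1` from `s + 1`, where `t = β^m s`. As `L < 2`, at most one of `t - 1`, `t + 1` is interior.
If there is one, the pair `(u, v)` of counts at `s` and `s + 1` obeys the Fibonacci recursion
`(u, v) ↦ (u, u + v)` or `(u + v, v)`, with growth `φ^(1/m)`. If there is none, both branches merge
at `t`, so that the count has doubled in `m + 1` steps, with growth `2^(1/(m+1))`. Mixing the two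
regimes gains nothing, and each is realised forever by a periodic point, so the maximal growth
exponent is the larger of the two numbers: the first for `m = 2`, the second for `m ≥ 3`.
-/

section Expansions

variable {β x : ℝ}

theorem mul_one_div_sub_one_eq_add_one (hβ : 1 < β) :
    β * (1 / (β - 1)) = 1 / (β - 1) + 1 := by
  have : β - 1 ≠ 0 := sub_ne_zero.2 hβ.ne'
  field_simp
  ring

theorem one_le_one_div_sub_one (hβ : 1 < β) (hβ2 : β ≤ 2) : 1 ≤ 1 / (β - 1) := by
  rw [le_div_iff₀ (sub_pos.2 hβ)]
  linarith

theorem isBetaExpansion_iff_shift (hβ : β ≠ 0) (a : ℕ → Fin 2) :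
    IsBetaExpansion β x a ↔
      IsBetaExpansion β (β * x - ((a 0 : ℕ) : ℝ)) (fun k => a (k + 1)) := by
  have head : β * (x - ∑ i ∈ Finset.range 1, ((a i : ℕ) : ℝ) * (β ^ (i + 1))⁻¹) =
      β * x - ((a 0 : ℕ) : ℝ) := by
    rw [Finset.sum_range_one]
    field_simp
    ring
  have tail (k : ℕ) : β * (((a (k + 1) : ℕ) : ℝ) * (β ^ (k + 1 + 1))⁻¹) =
      ((a (k + 1) : ℕ) : ℝ) * (β ^ (k + 1))⁻¹ := by
    rw [pow_succ β (k + 1)]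
    field_simp
  rw [IsBetaExpansion, IsBetaExpansion, ← hasSum_nat_add_iff' 1, ← hasSum_mul_left_iff hβ, head,
    funext tail]

theorem hasSum_inv_pow_succ (hβ : 1 < β) :
    HasSum (fun k : ℕ => (β ^ (k + 1))⁻¹) (1 / (β - 1)) := by
  have value : β⁻¹ * (1 - β⁻¹)⁻¹ = 1 / (β - 1) := by
    rw [← mul_inv, mul_sub, mul_inv_cancel₀ (by positivity), mul_one, one_div]
  have geometric := (hasSum_geometric_of_lt_one (by positivity)
    (inv_lt_one_of_one_lt₀ hβ)).mul_left β⁻¹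
  rw [value] at geometric
  exact geometric.congr_fun fun k => by rw [pow_succ, mul_inv, mul_comm, inv_pow]

theorem IsBetaExpansion.mem_Icc (hβ : 1 < β) {a : ℕ → Fin 2} (h : IsBetaExpansion β x a) :
    x ∈ Set.Icc 0 (1 / (β - 1)) := by
  refine ⟨h.nonneg fun k => by positivity, hasSum_le (fun k => ?_) h (hasSum_inv_pow_succ hβ)⟩
  have digit_le_one : ((a k : ℕ) : ℝ) ≤ 1 := by exact_mod_cast Nat.lt_succ_iff.1 (a k).2
  exact mul_le_of_le_one_left (by positivity) digit_le_one

theorem isBetaExpansion_of_bounded_remainders (hβ : 1 < β) {a : ℕ → Fin 2} {r : ℕ → ℝ} {C : ℝ}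
    (hr : ∀ n, r (n + 1) = β * r n - ((a n : ℕ) : ℝ)) (hC : ∀ n, |r n| ≤ C) :
    IsBetaExpansion β (r 0) a := by
  have partial_sum (n : ℕ) : ∑ k ∈ Finset.range n, ((a k : ℕ) : ℝ) * (β ^ (k + 1))⁻¹ =
      r 0 - r n * (β ^ n)⁻¹ := by
    induction n with
    | zero => simp
    | succ n ih =>
      rw [Finset.sum_range_succ, ih, hr]
      field_simp
      ring
  have inv_pow_tendsto : Tendsto (fun n => (β ^ n)⁻¹) atTop (𝓝 0) :=
    tendsto_inv_atTop_zero.comp (tendsto_pow_atTop_atTop_of_one_lt hβ)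
  have remainder_tendsto : Tendsto (fun n => r n * (β ^ n)⁻¹) atTop (𝓝 0) :=
    bdd_le_mul_tendsto_zero' C (Eventually.of_forall hC) inv_pow_tendsto
  rw [IsBetaExpansion, hasSum_iff_tendsto_nat_of_nonneg (fun k => by positivity)]
  simpa only [partial_sum, sub_zero] using remainder_tendsto.const_sub (r 0)

theorem exists_digit_mul_sub_mem_Icc (hβ : 1 < β) (hβ2 : β ≤ 2)
    (hx : x ∈ Set.Icc 0 (1 / (β - 1))) :
    ∃ d : Fin 2, β * x - ((d : ℕ) : ℝ) ∈ Set.Icc 0 (1 / (β - 1)) := by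
  have hL := one_le_one_div_sub_one hβ hβ2
  have upper : β * x ≤ 1 / (β - 1) + 1 := by
    rw [← mul_one_div_sub_one_eq_add_one hβ]
    exact mul_le_mul_of_nonneg_left hx.2 (by linarith)
  rcases le_total 1 (β * x) with h | h
  · exact ⟨1, by simpa using h, by simpa using upper⟩
  · refine ⟨0, ?_, ?_⟩
    · simpa using mul_nonneg (by linarith) hx.1
    · simpa using h.trans hL

theorem exists_isBetaExpansion (hβ : 1 < β) (hβ2 : β ≤ 2) (hx : x ∈ Set.Icc 0 (1 / (β - 1))) :
    ∃ a, IsBetaExpansion β x a := by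
  have next_exists (y : Set.Icc 0 (1 / (β - 1))) :
      ∃ (d : Fin 2) (z : Set.Icc 0 (1 / (β - 1))), (z : ℝ) = β * y - ((d : ℕ) : ℝ) := by
    obtain ⟨d, hd⟩ := exists_digit_mul_sub_mem_Icc hβ hβ2 y.2
    exact ⟨d, ⟨_, hd⟩, rfl⟩
  choose digit next hnext using next_exists
  refine ⟨fun n => digit (next^[n] ⟨x, hx⟩),
    isBetaExpansion_of_bounded_remainders (r := fun n => next^[n] ⟨x, hx⟩) hβ (fun n => ?_)
      (C := 1 / (β - 1)) fun n => ?_⟩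
  · rw [Function.iterate_succ_apply', hnext]
  · rw [abs_of_nonneg (next^[n] ⟨x, hx⟩).2.1]
    exact (next^[n] ⟨x, hx⟩).2.2

theorem cons_mem_prefixSet_iff (hβ : β ≠ 0) {n : ℕ} (d : Fin 2) (w : Fin n → Fin 2) :
    Fin.cons (α := fun _ => Fin 2) d w ∈ prefixSet β x (n + 1) ↔
      w ∈ prefixSet β (β * x - ((d : ℕ) : ℝ)) n := by
  constructor
  · rintro ⟨a, ha, haw⟩
    have head : a 0 = d := haw 0
    rw [isBetaExpansion_iff_shift hβ, head] at ha
    exact ⟨_, ha, fun i => by simpa using haw i.succ⟩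
  · rintro ⟨a, ha, haw⟩
    refine ⟨fun k => k.casesOn d a, ?_, Fin.cases rfl haw⟩
    rw [isBetaExpansion_iff_shift hβ]
    exact ha

theorem prefixSet_succ (hβ : β ≠ 0) (n : ℕ) :
    prefixSet β x (n + 1) =
      (Fin.cons (α := fun _ => Fin 2) 0) '' prefixSet β (β * x) n ∪
        (Fin.cons (α := fun _ => Fin 2) 1) '' prefixSet β (β * x - 1) n := by
  ext w
  obtain ⟨d, v, rfl⟩ : ∃ d v, w = Fin.cons d v := ⟨w 0, Fin.tail w, (Fin.cons_self_tail w).symm⟩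
  rw [cons_mem_prefixSet_iff hβ]
  fin_cases d <;> simp [Fin.cons_inj]

theorem ncard_prefixSet_succ (hβ : β ≠ 0) (n : ℕ) :
    (prefixSet β x (n + 1)).ncard =
      (prefixSet β (β * x) n).ncard + (prefixSet β (β * x - 1) n).ncard := by
  rw [prefixSet_succ hβ, Set.ncard_union_eq _ (Set.toFinite _) (Set.toFinite _),
    Set.ncard_image_of_injective _ (Fin.cons_right_injective _),
    Set.ncard_image_of_injective _ (Fin.cons_right_injective _)]
  rw [Set.disjoint_left]
  rintro _ ⟨v, -, rfl⟩ ⟨u, -, h⟩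
  exact one_ne_zero (congrFun h 0)

theorem ncard_prefixSet_eq_zero (hβ : 1 < β) (hx : x ∉ Set.Icc 0 (1 / (β - 1))) (n : ℕ) :
    (prefixSet β x n).ncard = 0 := by
  rw [Set.ncard_eq_zero]
  exact Set.eq_empty_of_forall_notMem fun _ ⟨_, ha, _⟩ => hx (ha.mem_Icc hβ)

theorem ncard_prefixSet_le_one_of_notMem_Ioo (hβ : 1 < β) (hx : x ∉ Set.Ioo 0 (1 / (β - 1)))
    (n : ℕ) : (prefixSet β x n).ncard ≤ 1 := by
  have hL := mul_one_div_sub_one_eq_add_one hβ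
  induction n generalizing x with
  | zero => simpa using Set.ncard_le_card (prefixSet β x 0)
  | succ n ih =>
    rw [ncard_prefixSet_succ (by positivity)]
    rcases le_or_gt x 0 with hx0 | hx0
    · have hβx : β * x ≤ 0 := mul_nonpos_of_nonneg_of_nonpos (by linarith) hx0
      rw [ncard_prefixSet_eq_zero (x := β * x - 1) hβ (fun h => by linarith [h.1]), add_zero]
      exact ih fun h => hβx.not_gt h.1
    · have hxL : 1 / (β - 1) ≤ x := not_lt.1 fun h => hx ⟨hx0, h⟩
      have hβx : 1 / (β - 1) + 1 ≤ β * x := hL ▸ mul_le_mul_of_nonneg_left hxL (by linarith)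
      rw [ncard_prefixSet_eq_zero (x := β * x) hβ (fun h => by linarith [h.2]), zero_add]
      exact ih fun h => by linarith [h.2]

theorem ncard_prefixSet_zero (hβ : 1 < β) (hβ2 : β ≤ 2) :
    (prefixSet β x 0).ncard = (Set.Icc 0 (1 / (β - 1))).indicator 1 x := by
  by_cases hx : x ∈ Set.Icc 0 (1 / (β - 1))
  · obtain ⟨a, ha⟩ := exists_isBetaExpansion hβ hβ2 hx
    have all : prefixSet β x 0 = Set.univ :=
      Set.eq_univ_of_forall fun _ => ⟨a, ha, fun i => i.elim0⟩
    rw [all, Set.indicator_of_mem hx]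
    simp
  · rw [ncard_prefixSet_eq_zero hβ hx, Set.indicator_of_notMem hx]

theorem growthExponent_le {lam C : ℝ} (hlam : 0 ≤ lam) (hC : 0 < C)
    (h : ∀ n, ((prefixSet β x n).ncard : ℝ) ≤ C * lam ^ n) : growthExponent β x ≤ lam := by
  have root_tendsto : Tendsto (fun n : ℕ => C ^ (1 / (n : ℝ))) atTop (𝓝 1) := by
    simpa using tendsto_const_nhds.rpow tendsto_one_div_atTop_nhds_zero_nat (Or.inl hC.ne')
  have bound_tendsto : Tendsto (fun n : ℕ => C ^ (1 / (n : ℝ)) * lam) atTop (𝓝 lam) := by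
    simpa using root_tendsto.mul_const lam
  rw [← bound_tendsto.limsup_eq]
  refine limsup_le_limsup ?_ (prefixSet_isCoboundedUnder β x) bound_tendsto.isBoundedUnder_le
  filter_upwards [eventually_gt_atTop 0] with n hn
  calc ((prefixSet β x n).ncard : ℝ) ^ (1 / (n : ℝ)) ≤ (C * lam ^ n) ^ (1 / (n : ℝ)) :=
        Real.rpow_le_rpow (by positivity) (h n) (by positivity)
    _ = C ^ (1 / (n : ℝ)) * lam := by
        rw [Real.mul_rpow hC.le (by positivity), one_div, Real.pow_rpow_inv_natCast hlam hn.ne']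

theorem rpow_one_div_le_growthExponent {c : ℝ} (hc : 0 ≤ c) {q : ℕ} (hq : q ≠ 0)
    (h : ∀ k, c ^ k ≤ ((prefixSet β x (q * k)).ncard : ℝ)) :
    c ^ (1 / (q : ℝ)) ≤ growthExponent β x := by
  refine le_limsup_of_frequently_le (frequently_atTop.2 fun N => ?_)
    (prefixSet_isBoundedUnder β x)
  refine ⟨q * (N + 1), by nlinarith [Nat.pos_of_ne_zero hq], ?_⟩
  calc c ^ (1 / (q : ℝ)) = (c ^ (N + 1)) ^ (1 / ((q * (N + 1) : ℕ) : ℝ)) := by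
        rw [← Real.rpow_natCast, ← Real.rpow_mul hc]
        congr 1
        push_cast
        field_simp
    _ ≤ _ := Real.rpow_le_rpow (by positivity) (h (N + 1)) (by positivity)

end Expansions

section OrbitCount

/-- The number of words `d₁ ⋯ dₙ` of digits in `{0, 1}` such that applying `y ↦ β y - d₁`, …,
`y ↦ β y - dₙ` successively takes `x` into `U`. With `U = [0, 1/(β-1)]` this counts the prefixes of
`β`-expansions of `x`. -/
noncomputable def orbitCount (β : ℝ) (U : Set ℝ) : ℕ → ℝ → ℕ
  | 0, x => U.indicator 1 x
  | n + 1, x => orbitCount β U n (β * x) + orbitCount β U n (β * x - 1)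

variable {β : ℝ} {U : Set ℝ} {m : ℕ}

theorem orbitCount_zero_of_mem {x : ℝ} (hx : x ∈ U) : orbitCount β U 0 x = 1 :=
  Set.indicator_of_mem hx 1

theorem orbitCount_zero_le_one (x : ℝ) : orbitCount β U 0 x ≤ 1 :=
  Set.indicator_le_self' (fun _ _ => zero_le_one) x

theorem ncard_prefixSet_eq_orbitCount (hβ : 1 < β) (hβ2 : β ≤ 2) (n : ℕ) (x : ℝ) :
    (prefixSet β x n).ncard = orbitCount β (Set.Icc 0 (1 / (β - 1))) n x := by
  induction n generalizing x with
  | zero => exact ncard_prefixSet_zero hβ hβ2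
  | succ n ih => rw [ncard_prefixSet_succ (by positivity), ih, ih, orbitCount]

theorem orbitCount_one_div_sub_one_sub (hβ : 1 < β) (hU : ∀ x, 1 / (β - 1) - x ∈ U ↔ x ∈ U)
    (n : ℕ) (x : ℝ) : orbitCount β U n (1 / (β - 1) - x) = orbitCount β U n x := by
  induction n generalizing x with
  | zero => classical exact if_congr (hU x) rfl rfl
  | succ n ih =>
    have hL := mul_one_div_sub_one_eq_add_one hβ
    have one_branch : β * (1 / (β - 1) - x) = 1 / (β - 1) - (β * x - 1) := by
      linear_combination hL
    have zero_branch : β * (1 / (β - 1) - x) - 1 = 1 / (β - 1) - β * x := by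
      linear_combination hL
    rw [orbitCount, orbitCount, zero_branch, one_branch, ih, ih, add_comm]

theorem orbitCount_eq_zero_of_nonpos (hβ : 0 ≤ β) (hU : ∀ x ∈ U, 0 < x) {x : ℝ} (hx : x ≤ 0)
    (n : ℕ) : orbitCount β U n x = 0 := by
  induction n generalizing x with
  | zero => exact Set.indicator_of_notMem (fun h => hx.not_gt (hU x h)) 1
  | succ n ih =>
    have hβx : β * x ≤ 0 := mul_nonpos_of_nonneg_of_nonpos hβ hx
    rw [orbitCount, ih hβx, ih (by linarith)]

theorem orbitCount_pow_mul_le (n k : ℕ) (x : ℝ) :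
    orbitCount β U n (β ^ k * x) ≤ orbitCount β U (n + k) x := by
  induction k generalizing x with
  | zero => simp
  | succ k ih =>
    rw [pow_succ, mul_assoc]
    exact (ih _).trans (Nat.le_add_right _ _)

theorem orbitCount_add_eq_of_pow_mul_le_one (hβ : 1 ≤ β) (hU : ∀ x ∈ U, 0 < x) (n k : ℕ) {x : ℝ}
    (hx0 : 0 ≤ x) (hx : β ^ k * x ≤ 1) :
    orbitCount β U (n + k) x = orbitCount β U n (β ^ k * x) := by
  induction k generalizing x with
  | zero => simp
  | succ k ih =>
    rw [pow_succ, mul_assoc] at hx ⊢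
    have hβx : 0 ≤ β * x := by positivity
    have hβx1 : β * x ≤ 1 := (le_mul_of_one_le_left hβx (one_le_pow₀ hβ)).trans hx
    rw [← add_assoc, orbitCount, ih hβx hx,
      orbitCount_eq_zero_of_nonpos (by positivity) hU (sub_nonpos.2 hβx1), add_zero]

theorem add_orbitCount_le_orbitCount_add (hm : m ≠ 0) (n : ℕ) (s : ℝ) :
    orbitCount β U n (β ^ m * s) + orbitCount β U n (β ^ m * s - 1) ≤
      orbitCount β U (n + m) s := by
  obtain ⟨k, rfl⟩ := Nat.exists_eq_succ_of_ne_zero hm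
  have h := orbitCount_pow_mul_le (β := β) (U := U) (n + 1) k s
  rwa [orbitCount, ← mul_assoc, ← pow_succ', add_right_comm] at h

theorem orbitCount_add_eq_add (hβ : 1 ≤ β) (hU : ∀ x ∈ U, 0 < x) (hm : m ≠ 0) (n : ℕ) {s : ℝ}
    (hs0 : 0 ≤ s) (hs : β ^ m * s ≤ β) :
    orbitCount β U (n + m) s =
      orbitCount β U n (β ^ m * s) + orbitCount β U n (β ^ m * s - 1) := by
  obtain ⟨k, rfl⟩ := Nat.exists_eq_succ_of_ne_zero hm
  rw [Nat.succ_eq_add_one, pow_succ', mul_assoc] at *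
  have hs1 : β ^ k * s ≤ 1 := le_of_mul_le_mul_left (by linarith) (zero_lt_one.trans_le hβ)
  rw [add_comm k, ← add_assoc, orbitCount_add_eq_of_pow_mul_le_one hβ hU (n + 1) k hs0 hs1,
    orbitCount]

end OrbitCount

section MultinacciEquation

variable {β : ℝ} {U : Set ℝ} {m : ℕ}

theorem lt_two_of_pow_mul_two_sub_eq_one (hβ : 0 ≤ β) (hroot : β ^ m * (2 - β) = 1) : β < 2 :=
  sub_pos.1 (pos_of_mul_pos_right (hroot.symm ▸ zero_lt_one) (by positivity))

theorem pow_mul_one_div_sub_one_sub_one (hβ : 1 < β) (hroot : β ^ m * (2 - β) = 1) :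
    β ^ m * (1 / (β - 1) - 1) = 1 / (β - 1) := by
  have : β - 1 ≠ 0 := sub_ne_zero.2 hβ.ne'
  field_simp
  linear_combination hroot

theorem one_div_sub_one_le_self (hβ : 1 < β) (hm : 2 ≤ m) (hroot : β ^ m * (2 - β) = 1) :
    1 / (β - 1) ≤ β := by
  have hβ2 := lt_two_of_pow_mul_two_sub_eq_one (by linarith) hroot
  have sq_bound : β ^ 2 * (2 - β) ≤ 1 := by
    rw [← hroot]
    exact mul_le_mul_of_nonneg_right (pow_le_pow_right₀ hβ.le hm) (by linarith)
  have factored : 0 ≤ (β - 1) * (β * (β - 1) - 1) := by linear_combination sq_bound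
  rw [div_le_iff₀ (sub_pos.2 hβ)]
  linarith [nonneg_of_mul_nonneg_right factored (sub_pos.2 hβ)]

theorem add_orbitCount_le_orbitCount_add_one (hβ : 1 < β) (hm : m ≠ 0)
    (hroot : β ^ m * (2 - β) = 1) (hU : ∀ x, 1 / (β - 1) - x ∈ U ↔ x ∈ U) (n : ℕ) (s : ℝ) :
    orbitCount β U n (β ^ m * s) + orbitCount β U n (β ^ m * s + 1) ≤
      orbitCount β U (n + m) (s + 1) := by
  have hL := pow_mul_one_div_sub_one_sub_one hβ hroot
  have reflect := orbitCount_one_div_sub_one_sub hβ hU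
  have h := add_orbitCount_le_orbitCount_add (β := β) (U := U) hm n (1 / (β - 1) - (s + 1))
  rwa [reflect, show β ^ m * (1 / (β - 1) - (s + 1)) = 1 / (β - 1) - β ^ m * s by
    linear_combination hL, reflect, sub_sub, reflect] at h

theorem two_mul_orbitCount_le (hβ : 1 < β) (hroot : β ^ m * (2 - β) = 1)
    (hU : ∀ x, 1 / (β - 1) - x ∈ U ↔ x ∈ U) {x : ℝ} (hx : β ^ m * (β * x - 1) = x) (n : ℕ) :
    2 * orbitCount β U n x ≤ orbitCount β U (n + (m + 1)) x := by
  have hL := pow_mul_one_div_sub_one_sub_one hβ hroot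
  have reflect := orbitCount_one_div_sub_one_sub hβ hU
  have zero_branch := orbitCount_pow_mul_le (β := β) (U := U) n m (1 / (β - 1) - β * x)
  have one_branch := orbitCount_pow_mul_le (β := β) (U := U) n m (β * x - 1)
  rw [show β ^ m * (1 / (β - 1) - β * x) = 1 / (β - 1) - x by linear_combination hL - hx,
    reflect, reflect] at zero_branch
  rw [hx] at one_branch
  rw [← add_assoc, orbitCount]
  lia

theorem two_pow_le_orbitCount (hβ : 1 < β) (hroot : β ^ m * (2 - β) = 1)
    (hU : ∀ x, 1 / (β - 1) - x ∈ U ↔ x ∈ U) {x : ℝ} (hx : β ^ m * (β * x - 1) = x) (hxU : x ∈ U)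
    (k : ℕ) : 2 ^ k ≤ orbitCount β U ((m + 1) * k) x := by
  induction k with
  | zero => exact (orbitCount_zero_of_mem hxU).ge
  | succ k ih =>
    rw [mul_add_one, pow_succ']
    exact (Nat.mul_le_mul_left 2 ih).trans (two_mul_orbitCount_le hβ hroot hU hx _)

theorem fib_le_orbitCount (hβ : 1 < β) (hm : m ≠ 0) (hroot : β ^ m * (2 - β) = 1)
    (hU : ∀ x, 1 / (β - 1) - x ∈ U ↔ x ∈ U) {s t : ℝ} (hst : β ^ m * s = t)
    (hts : β ^ m * t = s + 1) (hs : s ∈ U) (hs' : s + 1 ∈ U) (ht : t ∈ U) (ht' : t + 1 ∈ U)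
    (k : ℕ) :
    (Nat.fib (k + 1) ≤ orbitCount β U (m * k) s ∧
        Nat.fib (k + 2) ≤ orbitCount β U (m * k) (s + 1)) ∧
      Nat.fib (k + 2) ≤ orbitCount β U (m * k) t ∧
        Nat.fib (k + 1) ≤ orbitCount β U (m * k) (t + 1) := by
  induction k with
  | zero => simp [orbitCount_zero_of_mem, hs, hs', ht, ht']
  | succ k ih =>
    obtain ⟨⟨ih_s, ih_s'⟩, ih_t, ih_t'⟩ := ih
    have lower := add_orbitCount_le_orbitCount_add (β := β) (U := U) hm (m * k)
    have upper := add_orbitCount_le_orbitCount_add_one hβ hm hroot hU (m * k)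
    have lower_s := lower s
    have upper_s := upper s
    have lower_t := lower t
    have upper_t := upper t
    rw [hst] at lower_s upper_s
    rw [hts] at lower_t upper_t
    rw [add_sub_cancel_right] at lower_t
    rw [mul_add_one, Nat.fib_add_two (n := k + 1), add_assoc k]
    lia

theorem exists_rpow_two_le_growthExponent (hβ : 1 < β) (hroot : β ^ m * (2 - β) = 1) :
    ∃ x ∈ Set.Icc 0 (1 / (β - 1)),
      (2 : ℝ) ^ (1 / ((m : ℝ) + 1)) ≤ growthExponent β x := by
  have hβ2 := lt_two_of_pow_mul_two_sub_eq_one (by linarith) hroot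
  have hpow : 1 ≤ β ^ m := one_le_pow₀ hβ.le
  have hpow' : 1 < β ^ (m + 1) := one_lt_pow₀ hβ m.succ_ne_zero
  have hden : β ^ (m + 1) - 1 ≠ 0 := (sub_pos.2 hpow').ne'
  -- `x` has the periodic expansion `(1 0 ⋯ 0)^∞` of period `m + 1`.
  set x := β ^ m / (β ^ (m + 1) - 1) with hx
  have periodic : β ^ m * (β * x - 1) = x := by
    rw [hx]
    field_simp
    ring
  have x_mem : x ∈ Set.Icc 0 (1 / (β - 1)) := by
    refine ⟨div_nonneg (by positivity) (by linarith), ?_⟩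
    rw [hx, div_le_div_iff₀ (by linarith) (by linarith), pow_succ]
    linarith
  refine ⟨x, x_mem, ?_⟩
  rw [← Nat.cast_add_one]
  refine rpow_one_div_le_growthExponent zero_le_two m.succ_ne_zero fun k => ?_
  rw [ncard_prefixSet_eq_orbitCount hβ hβ2.le]
  exact_mod_cast two_pow_le_orbitCount hβ hroot (fun _ => Set.sub_mem_Icc_zero_iff_right)
    periodic x_mem k

theorem goldenRatio_pow_le_fib (n : ℕ) : Real.goldenRatio ^ n ≤ Nat.fib (n + 2) := by
  have h := Real.goldenRatio_mul_fib_succ_add_fib n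
  have fib_le : (Nat.fib n : ℝ) ≤ Real.goldenRatio * Nat.fib n :=
    le_mul_of_one_le_left (by positivity) Real.one_lt_goldenRatio.le
  refine le_of_mul_le_mul_left ?_ Real.goldenRatio_pos
  rw [← pow_succ', ← h, Nat.fib_add_two]
  push_cast
  linarith

theorem exists_rpow_goldenRatio_le_growthExponent (hβ : 1 < β) (hm : m ≠ 0)
    (hroot : β ^ m * (2 - β) = 1) :
    ∃ x ∈ Set.Icc 0 (1 / (β - 1)),
      Real.goldenRatio ^ (1 / (m : ℝ)) ≤ growthExponent β x := by
  have hβ2 := lt_two_of_pow_mul_two_sub_eq_one (by linarith) hroot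
  have hL : 1 / (β - 1) - 1 = 1 / (β ^ m * (β - 1)) := by
    have : β - 1 ≠ 0 := sub_ne_zero.2 hβ.ne'
    field_simp
    linear_combination hroot
  have hpow : 1 < β ^ m := one_lt_pow₀ hβ hm
  have hden : 0 < (β ^ m) ^ 2 - 1 := sub_pos.2 (one_lt_pow₀ hpow two_ne_zero)
  -- `s` has the periodic expansion `(0 ⋯ 0 1)^∞` of period `2 m`.
  set s := 1 / ((β ^ m) ^ 2 - 1) with hs
  have hs0 : 0 ≤ s := by positivity
  have hst : s ≤ β ^ m * s := le_mul_of_one_le_left hs0 hpow.le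
  have periodic : β ^ m * (β ^ m * s) = s + 1 := by
    rw [hs]
    field_simp
    ring
  have t_le : β ^ m * s + 1 ≤ 1 / (β - 1) := by
    rw [← le_sub_iff_add_le, hL, hs, mul_one_div, div_le_div_iff₀ hden (by nlinarith)]
    nlinarith
  refine ⟨s + 1, ⟨by linarith, by linarith⟩, ?_⟩
  refine rpow_one_div_le_growthExponent Real.goldenRatio_pos.le hm fun k => ?_
  rw [ncard_prefixSet_eq_orbitCount hβ hβ2.le]
  refine (goldenRatio_pow_le_fib k).trans (Nat.cast_le.2 ?_)
  refine (fib_le_orbitCount hβ hm hroot (fun _ => Set.sub_mem_Icc_zero_iff_right) rfl periodic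
    ?_ ?_ ?_ ?_ k).1.2 <;> constructor <;> linarith

end MultinacciEquation

section InteriorCount

/-- The number of branches of length `n` that take `x` into the interior of `[0, 1/(β-1)]`. An
endpoint has only one continuation, so leaving the endpoints out changes the number of prefixes by
at most a linear factor, while in the open interval the boundary cases of branching disappear. -/
noncomputable def interiorCount (β : ℝ) (n : ℕ) (x : ℝ) : ℕ :=
  orbitCount β (Set.Ioo 0 (1 / (β - 1))) n x

variable {β : ℝ} {m n : ℕ}

theorem interiorCount_zero_of_mem {x : ℝ} (hx : x ∈ Set.Ioo 0 (1 / (β - 1))) :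
    interiorCount β 0 x = 1 :=
  orbitCount_zero_of_mem hx

theorem interiorCount_zero_le_one (x : ℝ) : interiorCount β 0 x ≤ 1 :=
  orbitCount_zero_le_one x

theorem interiorCount_succ (n : ℕ) (x : ℝ) :
    interiorCount β (n + 1) x = interiorCount β n (β * x) + interiorCount β n (β * x - 1) :=
  rfl

theorem interiorCount_one_div_sub_one_sub (hβ : 1 < β) (n : ℕ) (x : ℝ) :
    interiorCount β n (1 / (β - 1) - x) = interiorCount β n x :=
  orbitCount_one_div_sub_one_sub hβ (fun _ => Set.sub_mem_Ioo_zero_iff_right) n x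

theorem interiorCount_eq_zero_of_nonpos (hβ : 0 ≤ β) {x : ℝ} (hx : x ≤ 0) (n : ℕ) :
    interiorCount β n x = 0 :=
  orbitCount_eq_zero_of_nonpos hβ (fun _ h => h.1) hx n

theorem interiorCount_eq_zero_of_ge (hβ : 1 < β) {x : ℝ} (hx : 1 / (β - 1) ≤ x) (n : ℕ) :
    interiorCount β n x = 0 := by
  rw [← interiorCount_one_div_sub_one_sub hβ]
  exact interiorCount_eq_zero_of_nonpos (by linarith) (sub_nonpos.2 hx) n

theorem ncard_prefixSet_le_two_mul_sum_interiorCount (hβ : 1 < β) (n : ℕ) (x : ℝ) :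
    (prefixSet β x n).ncard ≤ 2 * ∑ k ∈ Finset.range (n + 1), interiorCount β k x + 1 := by
  induction n generalizing x with
  | zero =>
    have : (prefixSet β x 0).ncard ≤ 1 := by simpa using Set.ncard_le_card (prefixSet β x 0)
    lia
  | succ n ih =>
    by_cases hx : x ∈ Set.Ioo 0 (1 / (β - 1))
    · have sum_succ : ∑ k ∈ Finset.range (n + 1 + 1), interiorCount β k x =
          ∑ k ∈ Finset.range (n + 1), interiorCount β k (β * x) +
            ∑ k ∈ Finset.range (n + 1), interiorCount β k (β * x - 1) + 1 := by
        simp only [Finset.sum_range_succ', interiorCount_zero_of_mem hx, interiorCount_succ,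
          Finset.sum_add_distrib]
      rw [ncard_prefixSet_succ (by positivity), sum_succ]
      linarith [ih (β * x), ih (β * x - 1)]
    · exact (ncard_prefixSet_le_one_of_notMem_Ioo hβ hx _).trans (Nat.le_add_left _ _)

/-- Bounds for the interior counts at the pairs of points at distance `1` in `(0, 1/(β-1))`: each
count is at most `P` and the two together are at most `Q`. Such pairs are the images of a branching
point. By the symmetry `x ↦ 1/(β-1) - x` it is enough to bound the count at the lower point `s`. -/
def PairBound (β : ℝ) (n : ℕ) (P Q : ℝ) : Prop :=
  ∀ s ∈ Set.Ioo 0 (1 / (β - 1) - 1),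
    (interiorCount β n s : ℝ) ≤ P ∧ (interiorCount β n s : ℝ) + interiorCount β n (s + 1) ≤ Q

variable {S P Q P' Q' : ℝ}

theorem PairBound.mono (h : PairBound β n P Q) (hP : P ≤ P') (hQ : Q ≤ Q') :
    PairBound β n P' Q' :=
  fun s hs => ⟨(h s hs).1.trans hP, (h s hs).2.trans hQ⟩

theorem PairBound.interiorCount_add_one_le (hβ : 1 < β) (h : PairBound β n P Q) {s : ℝ}
    (hs : s ∈ Set.Ioo 0 (1 / (β - 1) - 1)) : (interiorCount β n (s + 1) : ℝ) ≤ P := by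
  rw [← interiorCount_one_div_sub_one_sub hβ]
  exact (h _ ⟨by linarith [hs.2], by linarith [hs.1]⟩).1

theorem PairBound.interiorCount_succ_le (hβ : 1 < β) (h : PairBound β n P Q)
    (hS : ∀ x, (interiorCount β n x : ℝ) ≤ S) (x : ℝ) :
    (interiorCount β (n + 1) x : ℝ) ≤ max S Q := by
  rw [interiorCount_succ, Nat.cast_add]
  rcases le_or_gt (β * x - 1) 0 with h0 | h0
  · rw [interiorCount_eq_zero_of_nonpos (by linarith) h0, Nat.cast_zero, add_zero]
    exact le_max_of_le_left (hS _)
  rcases le_or_gt (1 / (β - 1)) (β * x) with hL | hL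
  · rw [interiorCount_eq_zero_of_ge hβ hL, Nat.cast_zero, zero_add]
    exact le_max_of_le_left (hS _)
  · have pair := (h (β * x - 1) ⟨h0, by linarith⟩).2
    rw [sub_add_cancel, add_comm] at pair
    exact le_max_of_le_right pair

theorem pow_mul_mem_Ioo (hβ : 1 < β) (hroot : β ^ m * (2 - β) = 1) {s : ℝ}
    (hs : s ∈ Set.Ioo 0 (1 / (β - 1) - 1)) : β ^ m * s ∈ Set.Ioo 0 (1 / (β - 1)) := by
  have hpow : 0 < β ^ m := by positivity
  refine ⟨mul_pos hpow hs.1, ?_⟩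
  rw [← pow_mul_one_div_sub_one_sub_one hβ hroot]
  exact mul_lt_mul_of_pos_left hs.2 hpow

theorem interiorCount_add_eq_add (hβ : 1 < β) (hm : 2 ≤ m) (hroot : β ^ m * (2 - β) = 1) {s : ℝ}
    (hs : s ∈ Set.Ioo 0 (1 / (β - 1) - 1)) (n : ℕ) :
    interiorCount β (n + m) s =
      interiorCount β n (β ^ m * s) + interiorCount β n (β ^ m * s - 1) :=
  orbitCount_add_eq_add hβ.le (fun _ h => h.1) (by lia) n hs.1.le
    ((pow_mul_mem_Ioo hβ hroot hs).2.le.trans (one_div_sub_one_le_self hβ hm hroot))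

theorem interiorCount_add_one_eq_add (hβ : 1 < β) (hm : 2 ≤ m) (hroot : β ^ m * (2 - β) = 1)
    {s : ℝ} (hs : s ∈ Set.Ioo 0 (1 / (β - 1) - 1)) (n : ℕ) :
    interiorCount β (n + m) (s + 1) =
      interiorCount β n (β ^ m * s) + interiorCount β n (β ^ m * s + 1) := by
  have reflect := interiorCount_one_div_sub_one_sub hβ
  have h := interiorCount_add_eq_add hβ hm hroot (s := 1 / (β - 1) - (s + 1))
    ⟨by linarith [hs.2], by linarith [hs.1]⟩ n
  rwa [reflect, show β ^ m * (1 / (β - 1) - (s + 1)) = 1 / (β - 1) - β ^ m * s by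
    linear_combination pow_mul_one_div_sub_one_sub_one hβ hroot, reflect, sub_sub, reflect] at h

theorem PairBound.add (hβ : 1 < β) (hm : 2 ≤ m) (hroot : β ^ m * (2 - β) = 1)
    (h : PairBound β n P Q) (hS : ∀ x, (interiorCount β n x : ℝ) ≤ S) :
    PairBound β (n + m) (max S Q) (max (2 * S) (P + Q)) := by
  intro s hs
  have hL2 := (one_div_sub_one_le_self hβ hm hroot).trans_lt
    (lt_two_of_pow_mul_two_sub_eq_one (by linarith) hroot)
  rw [interiorCount_add_eq_add hβ hm hroot hs, interiorCount_add_one_eq_add hβ hm hroot hs]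
  obtain ⟨ht0, htL⟩ := pow_mul_mem_Ioo hβ hroot hs
  set t := β ^ m * s
  -- Since `1 / (β - 1) < 2`, at most one of `t - 1` and `t + 1` is interior.
  push_cast
  rcases lt_or_ge t (1 / (β - 1) - 1) with ht | ht
  · have pair := h t ⟨ht0, ht⟩
    rw [interiorCount_eq_zero_of_nonpos (x := t - 1) (by linarith) (by linarith), Nat.cast_zero]
    exact ⟨le_max_of_le_left (by linarith [hS t]), le_max_of_le_right (by linarith)⟩
  rw [interiorCount_eq_zero_of_ge (x := t + 1) hβ (by linarith), Nat.cast_zero]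
  rcases lt_or_ge 1 t with ht1 | ht1
  · have hs' : t - 1 ∈ Set.Ioo 0 (1 / (β - 1) - 1) := ⟨by linarith, by linarith⟩
    have pair := h (t - 1) hs'
    have upper := h.interiorCount_add_one_le hβ hs'
    rw [sub_add_cancel] at pair upper
    exact ⟨le_max_of_le_right (by linarith), le_max_of_le_right (by linarith)⟩
  · rw [interiorCount_eq_zero_of_nonpos (x := t - 1) (by linarith) (by linarith), Nat.cast_zero]
    exact ⟨le_max_of_le_left (by linarith [hS t]), le_max_of_le_left (by linarith [hS t])⟩

theorem interiorCount_le_one_of_lt (hβ : 1 < β) (hm : 2 ≤ m) (hroot : β ^ m * (2 - β) = 1)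
    (hn : n < m) {s : ℝ} (hs : s ∈ Set.Ioo 0 (1 / (β - 1) - 1)) : interiorCount β n s ≤ 1 := by
  have pow_succ_le : β * (β ^ n * s) ≤ β * 1 := by
    rw [← mul_assoc, ← pow_succ', mul_one]
    exact (mul_le_mul_of_nonneg_right (pow_le_pow_right₀ hβ.le hn) hs.1.le).trans
      ((pow_mul_mem_Ioo hβ hroot hs).2.le.trans (one_div_sub_one_le_self hβ hm hroot))
  have forced : interiorCount β (0 + n) s = interiorCount β 0 (β ^ n * s) :=
    orbitCount_add_eq_of_pow_mul_le_one hβ.le (fun _ h => h.1) 0 n hs.1.le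
      (le_of_mul_le_mul_left pow_succ_le (by linarith))
  rw [← zero_add n, forced]
  exact interiorCount_zero_le_one _

theorem pairBound_one_two_of_lt (hβ : 1 < β) (hm : 2 ≤ m) (hroot : β ^ m * (2 - β) = 1)
    (hn : n < m) : PairBound β n 1 2 := by
  intro s hs
  have lower := interiorCount_le_one_of_lt hβ hm hroot hn hs
  have upper := interiorCount_le_one_of_lt hβ hm hroot hn (s := 1 / (β - 1) - (s + 1))
    ⟨by linarith [hs.2], by linarith [hs.1]⟩
  rw [interiorCount_one_div_sub_one_sub hβ] at upper
  exact ⟨by exact_mod_cast lower, by exact_mod_cast add_le_add lower upper⟩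

end InteriorCount

section UpperBound

open Real (goldenRatio)

variable {β lam : ℝ} {m n : ℕ}

theorem PairBound.add_goldenRatio_mul_pow (hβ : 1 < β) (hm : 2 ≤ m)
    (hroot : β ^ m * (2 - β) = 1) (hlam : 1 < lam) (hgold : goldenRatio ≤ lam ^ m)
    (htwo : 2 ≤ lam ^ (m + 1))
    (h : PairBound β n (goldenRatio * lam ^ n) (goldenRatio ^ 2 * lam ^ n))
    (hS : ∀ x, (interiorCount β n x : ℝ) ≤ goldenRatio ^ 2 / lam * lam ^ n) :
    PairBound β (n + m) (goldenRatio * lam ^ (n + m)) (goldenRatio ^ 2 * lam ^ (n + m)) := by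
  have hφ := Real.goldenRatio_pos
  have hlam0 : 0 < lam := by linarith
  have div_le : goldenRatio ^ 2 / lam ≤ goldenRatio ^ 2 := div_le_self (by positivity) hlam.le
  have two_div_le : 2 * (goldenRatio ^ 2 / lam) ≤ goldenRatio ^ 2 * lam ^ m := by
    rw [mul_div_assoc', div_le_iff₀ hlam0, mul_assoc, ← pow_succ, mul_comm]
    exact mul_le_mul_of_nonneg_left htwo (by positivity)
  have sq_le : goldenRatio ^ 2 ≤ goldenRatio * lam ^ m := by
    rw [sq]
    exact mul_le_mul_of_nonneg_left hgold hφ.le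
  have add_sq_le : goldenRatio + goldenRatio ^ 2 ≤ goldenRatio ^ 2 * lam ^ m := by
    calc goldenRatio + goldenRatio ^ 2 = goldenRatio ^ 2 * goldenRatio := by
          linear_combination (-goldenRatio) * Real.goldenRatio_sq
      _ ≤ goldenRatio ^ 2 * lam ^ m := mul_le_mul_of_nonneg_left hgold (by positivity)
  have scale {a b : ℝ} (hab : a ≤ b * lam ^ m) : a * lam ^ n ≤ b * lam ^ (n + m) := by
    rw [add_comm, pow_add, ← mul_assoc]
    exact mul_le_mul_of_nonneg_right hab (by positivity)
  -- `(φ, φ ^ 2)` is an eigenvector of the Fibonacci step `(P, Q) ↦ (Q, P + Q)`.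
  refine (h.add hβ hm hroot hS).mono (max_le (scale (div_le.trans sq_le)) (scale sq_le))
    (max_le ?_ ?_)
  · rw [← mul_assoc]
    exact scale two_div_le
  · rw [← add_mul]
    exact scale add_sq_le

theorem interiorCount_le_and_pairBound (hβ : 1 < β) (hm : 2 ≤ m)
    (hroot : β ^ m * (2 - β) = 1) (hlam : 1 < lam) (hlam2 : lam ≤ 2)
    (hgold : goldenRatio ≤ lam ^ m) (htwo : 2 ≤ lam ^ (m + 1)) (n : ℕ) :
    (∀ x, (interiorCount β n x : ℝ) ≤ goldenRatio ^ 2 / lam * lam ^ n) ∧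
      PairBound β n (goldenRatio * lam ^ n) (goldenRatio ^ 2 * lam ^ n) := by
  have hφ := Real.one_lt_goldenRatio
  have hlam0 : 0 < lam := by linarith
  have two_le_sq : 2 ≤ goldenRatio ^ 2 := by linarith [Real.goldenRatio_sq]
  induction n using Nat.strong_induction_on with
  | h n ih =>
    refine ⟨fun x => ?_, ?_⟩
    · rcases n with - | n
      · have one_le : 1 ≤ goldenRatio ^ 2 / lam := (one_le_div hlam0).2 (by linarith)
        rw [pow_zero, mul_one]
        exact le_trans (by exact_mod_cast interiorCount_zero_le_one x) one_le
      · obtain ⟨single, pair⟩ := ih n n.lt_succ_self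
        rw [pow_succ' lam, ← mul_assoc, div_mul_cancel₀ _ hlam0.ne']
        refine (pair.interiorCount_succ_le hβ single x).trans (max_le ?_ le_rfl)
        exact mul_le_mul_of_nonneg_right (div_le_self (by positivity) hlam.le) (by positivity)
    · rcases lt_or_ge n m with hn | hn
      · have one_le_pow : 1 ≤ lam ^ n := one_le_pow₀ hlam.le
        refine (pairBound_one_two_of_lt hβ hm hroot hn).mono ?_ ?_ <;> nlinarith
      · obtain ⟨k, rfl⟩ := Nat.exists_eq_add_of_le' hn
        obtain ⟨single, pair⟩ := ih k (by lia)
        exact pair.add_goldenRatio_mul_pow hβ hm hroot hlam hgold htwo single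

theorem growthExponent_le_of_le_pow (hβ : 1 < β) (hm : 2 ≤ m)
    (hroot : β ^ m * (2 - β) = 1) (hlam : 1 < lam) (hlam2 : lam ≤ 2)
    (hgold : goldenRatio ≤ lam ^ m) (htwo : 2 ≤ lam ^ (m + 1)) (x : ℝ) :
    growthExponent β x ≤ lam := by
  have hlam0 : 0 < lam := by linarith
  set c := goldenRatio ^ 2 / lam
  have hc : 0 ≤ c := by positivity
  have coeff_nonneg : 0 ≤ c * (lam / (lam - 1)) :=
    mul_nonneg hc (div_nonneg hlam0.le (sub_nonneg.2 hlam.le))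
  have geometric_le (n : ℕ) :
      ∑ k ∈ Finset.range (n + 1), lam ^ k ≤ lam / (lam - 1) * lam ^ n := by
    rw [geom_sum_eq hlam.ne', div_mul_eq_mul_div, ← pow_succ']
    exact div_le_div_of_nonneg_right (sub_le_self _ zero_le_one) (sub_nonneg.2 hlam.le)
  refine growthExponent_le (C := 2 * (c * (lam / (lam - 1))) + 1) hlam0.le
    (by linarith) fun n => ?_
  calc ((prefixSet β x n).ncard : ℝ)
      ≤ 2 * ∑ k ∈ Finset.range (n + 1), (interiorCount β k x : ℝ) + 1 := by
        exact_mod_cast ncard_prefixSet_le_two_mul_sum_interiorCount hβ n x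
    _ ≤ 2 * ∑ k ∈ Finset.range (n + 1), c * lam ^ k + lam ^ n := by
        gcongr with k
        · exact (interiorCount_le_and_pairBound hβ hm hroot hlam hlam2 hgold htwo k).1 x
        · exact one_le_pow₀ hlam.le
    _ ≤ 2 * (c * (lam / (lam - 1) * lam ^ n)) + lam ^ n := by
        rw [← Finset.mul_sum]
        gcongr
        exact geometric_le n
    _ = (2 * (c * (lam / (lam - 1))) + 1) * lam ^ n := by ring

theorem maximalGrowthExponent_eq_max (hβ : 1 < β) (hm : 2 ≤ m) (hroot : β ^ m * (2 - β) = 1) :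
    maximalGrowthExponent β =
      max (goldenRatio ^ (1 / (m : ℝ))) ((2 : ℝ) ^ (1 / ((m : ℝ) + 1))) := by
  have hφ := Real.one_lt_goldenRatio
  have hm0 : m ≠ 0 := by lia
  have hβ2 := lt_two_of_pow_mul_two_sub_eq_one (by linarith) hroot
  have : Nonempty (Set.Icc (0 : ℝ) (1 / (β - 1))) :=
    ⟨0, le_rfl, zero_le_one.trans (one_le_one_div_sub_one hβ hβ2.le)⟩
  set lam := max (goldenRatio ^ (1 / (m : ℝ))) ((2 : ℝ) ^ (1 / ((m : ℝ) + 1)))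
  apply le_antisymm
  · have one_lt_two_rpow : (1 : ℝ) < 2 ^ (1 / ((m : ℝ) + 1)) :=
      Real.one_lt_rpow one_lt_two (by positivity)
    have lam_le_two : lam ≤ 2 :=
      max_le
        ((Real.rpow_le_self_of_one_le hφ.le
          (div_le_self zero_le_one (Nat.one_le_cast.2 (by lia)))).trans Real.goldenRatio_lt_two.le)
        (Real.rpow_le_self_of_one_le one_le_two
          (div_le_self zero_le_one (le_add_of_nonneg_left m.cast_nonneg)))
    have gold_le_pow : goldenRatio ≤ lam ^ m := by
      calc goldenRatio = (goldenRatio ^ (1 / (m : ℝ))) ^ m := by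
            rw [one_div, Real.rpow_inv_natCast_pow (by linarith) hm0]
        _ ≤ lam ^ m := pow_le_pow_left₀ (by positivity) (le_max_left _ _) m
    have two_le_pow : 2 ≤ lam ^ (m + 1) := by
      calc (2 : ℝ) = (2 ^ (1 / ((m : ℝ) + 1))) ^ (m + 1) := by
            rw [one_div, ← Nat.cast_add_one, Real.rpow_inv_natCast_pow zero_le_two m.succ_ne_zero]
        _ ≤ lam ^ (m + 1) := pow_le_pow_left₀ (by positivity) (le_max_right _ _) _
    exact ciSup_le fun x => growthExponent_le_of_le_pow hβ hm hroot
      (one_lt_two_rpow.trans_le (le_max_right _ _)) lam_le_two gold_le_pow two_le_pow x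
  · obtain ⟨x, hx, golden_le⟩ := exists_rpow_goldenRatio_le_growthExponent hβ hm0 hroot
    obtain ⟨y, hy, two_le⟩ := exists_rpow_two_le_growthExponent hβ hroot
    exact max_le (le_ciSup_of_le (bddAbove_growthExponent β) ⟨x, hx⟩ golden_le)
      (le_ciSup_of_le (bddAbove_growthExponent β) ⟨y, hy⟩ two_le)

end UpperBound

section Multinacci

open Real (goldenRatio)

variable {m : ℕ}

theorem multinacci_pos (hm : 2 ≤ m) : 0 < multinacci m := by
  obtain ⟨x, ⟨hx0, hx⟩, -⟩ := existsUnique_multinacci hm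
  exact hx0.trans_le ((multinacci_isGreatest hm).2 hx)

theorem one_lt_multinacci (hm : 2 ≤ m) : 1 < multinacci m := by
  have hpos := multinacci_pos hm
  refine (one_lt_pow_iff_of_nonneg hpos.le (by lia : m ≠ 0)).1 ?_
  calc 1 < ∑ i ∈ Finset.range 2, multinacci m ^ i := by simpa [Finset.sum_range_succ] using hpos
    _ ≤ ∑ i ∈ Finset.range m, multinacci m ^ i :=
        Finset.sum_le_sum_of_subset_of_nonneg (Finset.range_mono hm) fun _ _ _ => by positivity
    _ = multinacci m ^ m := (multinacci_isGreatest hm).1.symm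

theorem multinacci_pow_mul_two_sub (hm : 2 ≤ m) :
    multinacci m ^ m * (2 - multinacci m) = 1 := by
  have geometric := geom_sum_mul (multinacci m) m
  rw [← (multinacci_isGreatest hm).1] at geometric
  linear_combination -geometric

theorem rpow_one_div_le_rpow_one_div {a b : ℝ} (ha : 0 ≤ a) (hb : 0 ≤ b) {p q : ℕ} (hp : p ≠ 0)
    (hq : q ≠ 0) (h : a ^ q ≤ b ^ p) : a ^ (1 / (p : ℝ)) ≤ b ^ (1 / (q : ℝ)) := by
  refine le_of_pow_le_pow_left₀ (mul_ne_zero hp hq) (by positivity) ?_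
  rw [one_div, one_div, pow_mul, Real.rpow_inv_natCast_pow ha hp, pow_mul',
    Real.rpow_inv_natCast_pow hb hq]
  exact h

theorem two_sq_le_goldenRatio_pow_three : 2 ^ 2 ≤ goldenRatio ^ 3 := by
  nlinarith [Real.goldenRatio_sq, Real.one_lt_goldenRatio]

theorem goldenRatio_pow_succ_le_two_pow (hm : 3 ≤ m) : goldenRatio ^ (m + 1) ≤ 2 ^ m := by
  have hφ := Real.goldenRatio_pos
  induction m, hm using Nat.le_induction with
  | base =>
    calc goldenRatio ^ (3 + 1) = 3 * goldenRatio + 2 := by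
          linear_combination (goldenRatio ^ 2 + goldenRatio + 2) * Real.goldenRatio_sq
      _ ≤ 2 ^ 3 := by linarith [Real.goldenRatio_lt_two]
  | succ m _ ih =>
    rw [pow_succ, pow_succ 2]
    exact mul_le_mul ih Real.goldenRatio_lt_two.le hφ.le (by positivity)

end Multinacci

theorem mainTheorem6 (m : ℕ) (hm : 2 ≤ m) :
    maximalGrowthExponent (multinacci m) =
      if m = 2 then √Real.goldenRatio else (2 : ℝ) ^ (1 / ((m : ℝ) + 1)) := by
  have hφ := Real.goldenRatio_pos
  rw [maximalGrowthExponent_eq_max (one_lt_multinacci hm) hm (multinacci_pow_mul_two_sub hm),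
    ← Nat.cast_add_one]
  split_ifs with h
  · subst h
    rw [Real.sqrt_eq_rpow]
    exact max_eq_left (rpow_one_div_le_rpow_one_div zero_le_two hφ.le three_ne_zero two_ne_zero
      two_sq_le_goldenRatio_pow_three)
  · exact max_eq_right (rpow_one_div_le_rpow_one_div hφ.le zero_le_two (by lia) m.succ_ne_zero
      (goldenRatio_pow_succ_le_two_pow (by lia)))
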